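/- Let $S=\Lambda(\mathbb C^n)$ be a Grassmann algebra, $S(z)=S\otimes\mathbb C(z)$, let $\theta$ be a further odd variable and $D_\theta=\partial_\theta+\theta\partial_z$ on $S(z)[\theta]$. Let $G$ be an affine algebraic supergroup over $\mathbb C$ (for instance a simple simply connected one) with Lie superalgebra $\mathfrak g$; write $G(z)=G(S(z))$, $G(z,\theta)=G(S(z)[\theta])$, $\mathfrak g(z)=S(z)\otimes\mathfrak g$, $\mathfrak g_S=S\otimes\mathfrak g$. In a trivialization over an open dense subset, a meromorphic superconnection on the super Riemann sphere is an operator $\hat\nabla=D_\theta+A(z,\theta)$ with $A$ an odd element of $S(z)[\theta]\otimes\mathfrak g$, on which $g\in G(z,\theta)$ acts by $\hat\nabla\mapsto g^{-1}\hat\nabla g=D_\theta+g^{-1}Ag+g^{-1}(D_\theta g)$. For an even $\hat Z\in\mathfrak g_S$, $\hat\nabla$ is called $\hat Z$-twisted if $g^{-1}\hat\nabla g=D_\theta+\theta\hat Z$ for some $g\in G(z,\theta)$. Let $\hat\nabla=D_\theta+A$ be such a superconnection. Then $\hat\nabla=D_\theta+\theta M(z)+N(z)$ with $M\in\mathfrak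 g(z)$ even and $N\in\mathfrak g(z)$ odd, and with $$\tilde\nabla=\partial_z+\tfrac12[N(z),N(z)]+M(z),$$ where $\tfrac12[N,N]+M$ is an even element of $\mathfrak g(z)$, the following hold. 1. For every $U\in G(z)$, the element $g=(1-\theta N(z))U(z)$ lies in $G(z,\theta)$ and $g^{-1}\hat\nabla g=\partial_\theta+\theta\,U^{-1}\tilde\nabla U$. 2. The choice of $N$ is unique: if $R\in\mathfrak g(z)$ is odd, $U\in G(z)$ and $g=(1-\theta R)U$, then $g^{-1}\hat\nabla g$ has the form $\partial_\theta+\theta(\partial_z+B(z))$ for some $B$ if and only if $R=N$. Moreover an arbitrary $g\in G(z,\theta)$ brings $\hat\nabla$ to this form if and only if $g=(1-\theta N)U$ for some $U\in G(z)$. 3. For every even $\hat Z\in\mathfrak g_S$, $\hat\nabla$ is $\hat Z$-twisted if and only if the meromorphic connection $\tilde\nabla$ on $\mathbb P^1$ is gauge equivalent to the constant connection $\partial_z+\hat Z$, i.e. $U^{-1}\tilde\nabla U=\partial_z+\hat Z$ for some $U\in G(z)$. In particular, let Chevalley generators $e_i,f_i,\check\alpha_i$ of $\mathfrak g$ be chosen,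 let $\mathfrak b_+$ and $\mathfrak b_-$ be generated by the $e_i,\check\alpha_i$ and by the $f_i,\check\alpha_i$ respectively, and let $\hat\nabla$ underlie a Miura $G$-superoper: in some trivialization it has the form $D_\theta+\sum_i a_i(z,\theta)e_i+b(z,\theta)$ with nonzero $a_i$ of parity opposite to $e_i$ and $b$ odd and $\mathfrak b_-$-valued, and in some trivialization it takes values in $\mathfrak b_+$. Then the $\hat Z$-twisted condition for this Miura $G$-superoper is equivalent to $\tilde\nabla$ being gauge equivalent to the constant connection $\hat Z$. -/

import Mathlib

open scoped TensorProduct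

noncomputable section

/-! ## Superalgebras -/

/-- A complex associative superalgebra: since `2` is invertible, a `ℤ/2`-grading compatible with
the product is the same thing as an involutive algebra automorphism, the parity operator
`a ↦ (-1)^|a| a`. Even elements are its fixed points, odd elements its anti-fixed points. -/
class Superalgebra (R : Type*) [Ring R] [Algebra ℂ R] where
  parity : R →ₐ[ℂ] R
  parity_parity : ∀ a, parity (parity a) = a

/-- The parity operator `a ↦ (-1)^|a| a`. -/
def par (R : Type*) [Ring R] [Algebra ℂ R] [Superalgebra R] : R →ₐ[ℂ] R :=
  Superalgebra.parity

/-- Even elements. -/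
def IsEven {R : Type*} [Ring R] [Algebra ℂ R] [Superalgebra R] (a : R) : Prop := par R a = a

/-- Odd elements. -/
def IsOdd {R : Type*} [Ring R] [Algebra ℂ R] [Superalgebra R] (a : R) : Prop := par R a = -a

/-- Supercommutativity: even elements are central, odd elements anticommute. -/
def IsSupercommutative (R : Type*) [Ring R] [Algebra ℂ R] [Superalgebra R] : Prop :=
  (∀ a b : R, IsEven a → a * b = b * a) ∧ (∀ a b : R, IsOdd a → IsOdd b → a * b = -(b * a))

/-- The projection of a superalgebra to its even part. -/
def evenProj (R : Type*) [Ring R] [Algebra ℂ R] [Superalgebra R] : R →ₗ[ℂ] R :=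
  (1 / 2 : ℂ) • (LinearMap.id + (par R).toLinearMap)

/-- The projection of a superalgebra to its odd part. -/
def oddProj (R : Type*) [Ring R] [Algebra ℂ R] [Superalgebra R] : R →ₗ[ℂ] R :=
  (1 / 2 : ℂ) • (LinearMap.id - (par R).toLinearMap)

/-- The base field is purely even. -/
instance : Superalgebra ℂ where
  parity := AlgHom.id ℂ ℂ
  parity_parity _ := rfl

/-- The product of the super tensor product `R ⊗ R`:
`(a ⊗ b) (c ⊗ d) = (-1)^(|b| |c|) ac ⊗ bd`. (The product on the right-hand side of the definition
is the one without sign.) -/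
def superTensorMul {R : Type*} [Ring R] [Algebra ℂ R] [Superalgebra R]
    (X Y : R ⊗[ℂ] R) : R ⊗[ℂ] R :=
  X * TensorProduct.map (evenProj R) LinearMap.id Y
    + TensorProduct.map LinearMap.id (par R).toLinearMap X
        * TensorProduct.map (oddProj R) LinearMap.id Y

/-! ## Affine algebraic supergroups -/

/-- The coordinate superalgebra `O = ℂ[G]` of an affine algebraic supergroup `G` over `ℂ`: a finitely
generated supercommutative Hopf superalgebra. -/
class SuperHopfAlgebra (O : Type*) [Ring O] [Algebra ℂ O] [Superalgebra O] extends
    Coalgebra ℂ O where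
  supercommutative : IsSupercommutative O
  finitely_generated : ∃ s : Finset O, Algebra.adjoin ℂ (s : Set O) = ⊤
  counit_one : counit 1 = 1
  counit_mul : ∀ a b : O, counit (a * b) = counit a * counit b
  counit_par : ∀ a : O, counit (par O a) = counit a
  comul_one : comul 1 = 1 ⊗ₜ[ℂ] 1
  comul_mul : ∀ a b : O, comul (a * b) = superTensorMul (comul a) (comul b)
  comul_par : ∀ a : O,
    comul (par O a) = TensorProduct.map (par O).toLinearMap (par O).toLinearMap (comul a)
  antipode : O →ₗ[ℂ] O
  antipode_left :
    LinearMap.mul' ℂ O ∘ₗ antipode.rTensor O ∘ₗ comul = Algebra.linearMap ℂ O ∘ₗ counit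
  antipode_right :
    LinearMap.mul' ℂ O ∘ₗ antipode.lTensor O ∘ₗ comul = Algebra.linearMap ℂ O ∘ₗ counit

section Convolution

variable {O : Type*} [Ring O] [Algebra ℂ O] [Superalgebra O]
variable {R : Type*} [Ring R] [Algebra ℂ R] [Superalgebra R]

/-- The parity operator of the super vector space `Hom(O, R)`. -/
def homPar (f : O →ₗ[ℂ] R) : O →ₗ[ℂ] R :=
  (par R).toLinearMap ∘ₗ f ∘ₗ (par O).toLinearMap

/-- The even part of a linear map. -/
def homEven (f : O →ₗ[ℂ] R) : O →ₗ[ℂ] R := (1 / 2 : ℂ) • (f + homPar f)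

/-- The odd part of a linear map. -/
def homOdd (f : O →ₗ[ℂ] R) : O →ₗ[ℂ] R := (1 / 2 : ℂ) • (f - homPar f)

/-- Super convolution on `Hom(O, R)`: with `Δ x = ∑ x₁ ⊗ x₂`,
`(f ⋆ h)(x) = ∑ (-1)^(|h| |x₁|) f(x₁) h(x₂)`.
Both the `R`-points of `G` and `R ⊗ Lie G` live in this superalgebra, and their products below are
taken in it (for a matrix supergroup these are products of supermatrices). -/
def superConv [Coalgebra ℂ O] (f h : O →ₗ[ℂ] R) : O →ₗ[ℂ] R :=
  LinearMap.mul' ℂ R ∘ₗ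
    (TensorProduct.map f (homEven h)
      + TensorProduct.map (f ∘ₗ (par O).toLinearMap) (homOdd h)) ∘ₗ Coalgebra.comul

infixl:70 " ⋆ₛ " => superConv

/-- The superbracket `[f, h] = f h - (-1)^(|f| |h|) h f`. -/
def superBracket [Coalgebra ℂ O] (f h : O →ₗ[ℂ] R) : O →ₗ[ℂ] R :=
  f ⋆ₛ h - (homEven h ⋆ₛ f + homOdd h ⋆ₛ homPar f)

/-- The unit of convolution, that is, the unit element of `G(R)`. -/
def unitPoint (O : Type*) [Ring O] [Algebra ℂ O] [Coalgebra ℂ O]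
    (R : Type*) [Ring R] [Algebra ℂ R] : O →ₗ[ℂ] R :=
  Algebra.linearMap ℂ R ∘ₗ Coalgebra.counit

variable (O R) in
/-- The `R`-points `G(R)`: parity preserving algebra homomorphisms `O → R`. -/
def points : Set (O →ₗ[ℂ] R) :=
  {g | g 1 = 1 ∧ (∀ x y, g (x * y) = g x * g y) ∧ ∀ x, g (par O x) = par R (g x)}

/-- The inverse of a point of `G`. -/
def pointInv [SuperHopfAlgebra O] (g : O →ₗ[ℂ] R) : O →ₗ[ℂ] R :=
  g ∘ₗ SuperHopfAlgebra.antipode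

variable (O R) in
/-- `𝔤(R) = R ⊗ 𝔤`: tangent vectors to `G` at the unit element with values in `R`. For
`R = ℂ` this is the Lie superalgebra `𝔤` of `G`. (The usual sign in the Leibniz rule is invisible here,
since the counit vanishes on odd elements.) -/
def lie [Coalgebra ℂ O] : Submodule ℂ (O →ₗ[ℂ] R) where
  carrier := {f | ∀ x y, f (x * y) =
    Coalgebra.counit (R := ℂ) y • f x + Coalgebra.counit (R := ℂ) x • f y}
  zero_mem' := by intro x y; simp
  add_mem' := by
    intro f h hf hh x y
    simp only [LinearMap.add_apply, hf x y, hh x y, smul_add]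
    abel
  smul_mem' := by
    intro c f hf x y
    simp only [LinearMap.smul_apply, hf x y, smul_add, smul_comm c]

variable (O R) in
/-- Even elements of `𝔤(R)`. -/
def lieEven [Coalgebra ℂ O] : Set (O →ₗ[ℂ] R) :=
  {f | f ∈ lie O R ∧ ∀ x, par R (f x) = f (par O x)}

variable (O R) in
/-- Odd elements of `𝔤(R)`. -/
def lieOdd [Coalgebra ℂ O] : Set (O →ₗ[ℂ] R) :=
  {f | f ∈ lie O R ∧ ∀ x, par R (f x) = -f (par O x)}

/-- For an (even or odd) derivation `D` of `R`, the gauge transform of the connection `D + A` by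
`g ∈ G(R)`: `g⁻¹ (D + A) g = D + (g⁻¹ A g + g⁻¹ (D g))`. -/
def gaugeTransform [SuperHopfAlgebra O] (D : R →ₗ[ℂ] R) (g A : O →ₗ[ℂ] R) : O →ₗ[ℂ] R :=
  pointInv g ⋆ₛ A ⋆ₛ g + pointInv g ⋆ₛ (D ∘ₗ g)

end Convolution

/-! ## Adjoining the odd coordinate `θ` -/

/-- The superalgebra `R[θ]`, with `θ` odd: `⟨a, b⟩` stands for `a + θ b`. -/
@[ext]
structure Theta (R : Type*) where
  body : R
  coeff : R

namespace Theta

variable {R : Type*} [Ring R] [Algebra ℂ R] [Superalgebra R]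

instance : Zero (Theta R) := ⟨⟨0, 0⟩⟩
instance : One (Theta R) := ⟨⟨1, 0⟩⟩
instance : Add (Theta R) := ⟨fun x y => ⟨x.body + y.body, x.coeff + y.coeff⟩⟩
instance : Neg (Theta R) := ⟨fun x => ⟨-x.body, -x.coeff⟩⟩
instance : Sub (Theta R) := ⟨fun x y => ⟨x.body - y.body, x.coeff - y.coeff⟩⟩
instance : SMul ℂ (Theta R) := ⟨fun c x => ⟨c • x.body, c • x.coeff⟩⟩

/-- `(a + θ b)(c + θ d) = ac + θ (bc + (-1)^|a| ad)`. -/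
instance : Mul (Theta R) :=
  ⟨fun x y => ⟨x.body * y.body, x.coeff * y.body + par R x.body * y.coeff⟩⟩

@[simp] theorem zero_body : (0 : Theta R).body = 0 := rfl
@[simp] theorem zero_coeff : (0 : Theta R).coeff = 0 := rfl
@[simp] theorem one_body : (1 : Theta R).body = 1 := rfl
@[simp] theorem one_coeff : (1 : Theta R).coeff = 0 := rfl
@[simp] theorem add_body (x y : Theta R) : (x + y).body = x.body + y.body := rfl
@[simp] theorem add_coeff (x y : Theta R) : (x + y).coeff = x.coeff + y.coeff := rfl
@[simp] theorem neg_body (x : Theta R) : (-x).body = -x.body := rfl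
@[simp] theorem neg_coeff (x : Theta R) : (-x).coeff = -x.coeff := rfl
@[simp] theorem sub_body (x y : Theta R) : (x - y).body = x.body - y.body := rfl
@[simp] theorem sub_coeff (x y : Theta R) : (x - y).coeff = x.coeff - y.coeff := rfl
@[simp] theorem smul_body (c : ℂ) (x : Theta R) : (c • x).body = c • x.body := rfl
@[simp] theorem smul_coeff (c : ℂ) (x : Theta R) : (c • x).coeff = c • x.coeff := rfl
@[simp] theorem mul_body (x y : Theta R) : (x * y).body = x.body * y.body := rfl
@[simp] theorem mul_coeff (x y : Theta R) :
    (x * y).coeff = x.coeff * y.body + par R x.body * y.coeff := rfl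

instance : Ring (Theta R) where
  add_assoc x y z := by ext <;> simp [add_assoc]
  zero_add x := by ext <;> simp
  add_zero x := by ext <;> simp
  add_comm x y := by ext <;> simp [add_comm]
  neg_add_cancel x := by ext <;> simp
  sub_eq_add_neg x y := by ext <;> simp [sub_eq_add_neg]
  nsmul := nsmulRec
  zsmul := zsmulRec
  left_distrib x y z := by
    ext
    · simp [mul_add]
    · simp only [mul_coeff, add_body, add_coeff, mul_add]; abel
  right_distrib x y z := by
    ext
    · simp [add_mul]
    · simp only [mul_coeff, add_body, add_coeff, add_mul, map_add]; abel
  zero_mul x := by ext <;> simp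
  mul_zero x := by ext <;> simp
  mul_assoc x y z := by
    ext
    · simp [mul_assoc]
    · simp only [mul_coeff, mul_body, add_mul, mul_add, map_mul, mul_assoc]; abel
  one_mul x := by ext <;> simp
  mul_one x := by ext <;> simp

instance : Module ℂ (Theta R) where
  one_smul x := by ext <;> simp
  mul_smul a b x := by ext <;> simp [mul_smul]
  smul_zero a := by ext <;> simp
  smul_add a x y := by ext <;> simp
  add_smul a b x := by ext <;> simp [add_smul]
  zero_smul x := by ext <;> simp

instance : Algebra ℂ (Theta R) :=
  Algebra.ofModule (fun r x y => by ext <;> simp) (fun r x y => by ext <;> simp)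

/-- The element `θ` is odd: the parity of `a + θ b` is `(-1)^|a| a - θ (-1)^|b| b`. -/
instance : Superalgebra (Theta R) where
  parity := AlgHom.ofLinearMap
    { toFun := fun x => ⟨par R x.body, -par R x.coeff⟩
      map_add' := by intro x y; ext <;> simp [add_comm]
      map_smul' := by intro c x; ext <;> simp }
    (by ext <;> simp)
    (by intro x y; ext <;> simp [add_comm])
  parity_parity := by
    have h : ∀ a : R, par R (par R a) = a := Superalgebra.parity_parity
    intro x
    ext <;> simp [h]

variable (R) in
/-- The `θ`-independent part `a` of `a + θ b`, as a linear map. -/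
def bodyMap : Theta R →ₗ[ℂ] R where
  toFun x := x.body
  map_add' _ _ := rfl
  map_smul' _ _ := rfl

variable (R) in
/-- The coefficient `b` of `θ` in `a + θ b`, as a linear map. -/
def coeffMap : Theta R →ₗ[ℂ] R where
  toFun x := x.coeff
  map_add' _ _ := rfl
  map_smul' _ _ := rfl

variable (R) in
/-- The inclusion `R → R[θ]`. -/
def incl : R →ₗ[ℂ] Theta R where
  toFun a := ⟨a, 0⟩
  map_add' a b := by ext <;> simp
  map_smul' c a := by ext <;> simp

variable (R) in
/-- Left multiplication by `θ`, as a map `R → R[θ]`, `b ↦ θ b`. -/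
def thetaMul : R →ₗ[ℂ] Theta R where
  toFun b := ⟨0, b⟩
  map_add' a b := by ext <;> simp
  map_smul' c a := by ext <;> simp

/-- The odd vector field `D_θ = ∂_θ + θ ∂`, for `∂` acting on `R`:
`D_θ (a + θ b) = b + θ ∂ a`. -/
def superDeriv (D : R →ₗ[ℂ] R) : Theta R →ₗ[ℂ] Theta R where
  toFun x := ⟨x.coeff, D x.body⟩
  map_add' x y := by ext <;> simp
  map_smul' c x := by ext <;> simp

end Theta

/-! ## Rational functions with values in a Grassmann algebra -/

/-- The derivative `(p / q)' = (p' q - p q') / q²` of a rational function. -/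
def ratDerivFun (f : RatFunc ℂ) : RatFunc ℂ :=
  (algebraMap (Polynomial ℂ) (RatFunc ℂ)
      (Polynomial.derivative f.num * f.denom - f.num * Polynomial.derivative f.denom)) /
    (algebraMap (Polynomial ℂ) (RatFunc ℂ) f.denom) ^ 2

theorem ratDeriv_aux {P : Type*} [CommRing P] (a d p q a' d' p' q' : P) (h1 : a * q = p * d)
    (h2 : a' * q + a * q' = p' * d + p * d') :
    (a' * d - a * d') * q ^ 2 = (p' * q - p * q') * d ^ 2 := by
  linear_combination (q * d) * h2 - (d * q' + q * d') * h1

/-- The quotient rule for an arbitrary representation as a fraction. -/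
theorem ratDerivFun_div (p q : Polynomial ℂ) (hq : q ≠ 0) :
    ratDerivFun (algebraMap (Polynomial ℂ) (RatFunc ℂ) p / algebraMap (Polynomial ℂ) (RatFunc ℂ) q) =
      (algebraMap (Polynomial ℂ) (RatFunc ℂ)
        (Polynomial.derivative p * q - p * Polynomial.derivative q)) /
        (algebraMap (Polynomial ℂ) (RatFunc ℂ) q) ^ 2 := by
  obtain ⟨f, hf⟩ : ∃ f, f = algebraMap (Polynomial ℂ) (RatFunc ℂ) p /
      algebraMap (Polynomial ℂ) (RatFunc ℂ) q := ⟨_, rfl⟩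
  rw [← hf]
  have hinj := RatFunc.algebraMap_injective ℂ
  have hq' : algebraMap (Polynomial ℂ) (RatFunc ℂ) q ≠ 0 := by
    rwa [Ne, map_eq_zero_iff _ hinj]
  have hd' : algebraMap (Polynomial ℂ) (RatFunc ℂ) f.denom ≠ 0 := by
    rw [Ne, map_eq_zero_iff _ hinj]
    exact RatFunc.denom_ne_zero f
  have h1 : f.num * q = p * f.denom := by
    apply hinj
    rw [map_mul, map_mul, ← div_eq_div_iff hd' hq', RatFunc.num_div_denom f, hf]
  have h2 := congrArg Polynomial.derivative h1
  rw [Polynomial.derivative_mul, Polynomial.derivative_mul] at h2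
  have h3 := ratDeriv_aux _ _ _ _ _ _ _ _ h1 h2
  unfold ratDerivFun
  rw [div_eq_div_iff (pow_ne_zero 2 hd') (pow_ne_zero 2 hq'), ← map_pow, ← map_pow, ← map_mul,
    ← map_mul, h3]

/-- The derivation `∂_z` of `ℂ(z)`. -/
def ratDeriv : RatFunc ℂ →ₗ[ℂ] RatFunc ℂ where
  toFun := ratDerivFun
  map_add' f g := by
    have hinj := RatFunc.algebraMap_injective ℂ
    have hf : f.denom ≠ 0 := RatFunc.denom_ne_zero f
    have hg : g.denom ≠ 0 := RatFunc.denom_ne_zero g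
    have hf' : algebraMap (Polynomial ℂ) (RatFunc ℂ) f.denom ≠ 0 := by
      rwa [Ne, map_eq_zero_iff _ hinj]
    have hg' : algebraMap (Polynomial ℂ) (RatFunc ℂ) g.denom ≠ 0 := by
      rwa [Ne, map_eq_zero_iff _ hinj]
    have h : f + g = algebraMap (Polynomial ℂ) (RatFunc ℂ) (f.num * g.denom + g.num * f.denom) /
        algebraMap (Polynomial ℂ) (RatFunc ℂ) (f.denom * g.denom) := by
      conv_lhs => rw [← RatFunc.num_div_denom f, ← RatFunc.num_div_denom g]
      simp only [map_add, map_mul]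
      field_simp
    rw [h, ratDerivFun_div _ _ (mul_ne_zero hf hg)]
    unfold ratDerivFun
    simp only [Polynomial.derivative_mul, map_add, map_mul, map_sub]
    field_simp
    ring
  map_smul' c f := by
    have hinj := RatFunc.algebraMap_injective ℂ
    have hf : f.denom ≠ 0 := RatFunc.denom_ne_zero f
    have h : c • f = algebraMap (Polynomial ℂ) (RatFunc ℂ) (Polynomial.C c * f.num) /
        algebraMap (Polynomial ℂ) (RatFunc ℂ) f.denom := by
      conv_lhs => rw [← RatFunc.num_div_denom f]
      rw [map_mul, mul_div_assoc, RatFunc.algebraMap_C, RatFunc.smul_eq_C_mul]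
    rw [h, ratDerivFun_div _ _ hf]
    unfold ratDerivFun
    simp only [Polynomial.derivative_mul, Polynomial.derivative_C, RingHom.id_apply,
      RatFunc.smul_eq_C_mul, ← RatFunc.algebraMap_C, ← mul_div_assoc, ← map_mul]
    congr 2
    ring

/-- The Grassmann algebra `S` on `n` odd generators. -/
abbrev Grassmann (n : ℕ) : Type := ExteriorAlgebra ℂ (Fin n → ℂ)

instance (n : ℕ) : Superalgebra (Grassmann n) where
  parity := CliffordAlgebra.involute
  parity_parity := CliffordAlgebra.involute_involute

/-- `S(z) = ℂ(z) ⊗ S`. -/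
abbrev RatGrassmann (n : ℕ) : Type := RatFunc ℂ ⊗[ℂ] Grassmann n

instance (n : ℕ) : Superalgebra (RatGrassmann n) where
  parity := Algebra.TensorProduct.map (AlgHom.id ℂ (RatFunc ℂ)) (par (Grassmann n))
  parity_parity := by
    have h : ∀ s : Grassmann n, par (Grassmann n) (par (Grassmann n) s) = s :=
      Superalgebra.parity_parity
    intro a
    induction a using TensorProduct.induction_on with
    | zero => simp
    | tmul f s => simp [h]
    | add a b ha hb => rw [map_add, map_add, ha, hb]

/-- `∂_z` on `S(z)`. -/
def dz (n : ℕ) : RatGrassmann n →ₗ[ℂ] RatGrassmann n := ratDeriv.rTensor (Grassmann n)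

/-- The inclusion of the constants `S → S(z)`. -/
def constIncl (n : ℕ) : Grassmann n →ₗ[ℂ] RatGrassmann n :=
  (Algebra.TensorProduct.includeRight : Grassmann n →ₐ[ℂ] RatGrassmann n).toLinearMap

/-- `S(z)[θ]`: the rational functions on the super Riemann sphere. -/
abbrev SuperRat (n : ℕ) : Type := Theta (RatGrassmann n)

/-- `D_θ = ∂_θ + θ ∂_z` on `S(z)[θ]`. -/
def Dtheta (n : ℕ) : SuperRat n →ₗ[ℂ] SuperRat n := Theta.superDeriv (dz n)

/-! ## Meromorphic superconnections and their reduction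

A meromorphic flat superholomorphic connection on a `G`-bundle over the super Riemann sphere is, in
a trivialization over an open dense subset, the operator `D_θ + A` with `A` an odd element of
`𝔤(S(z)[θ])`, taken up to gauge transformations from `G(S(z)[θ])`. -/

section Connections

variable {O : Type*} [Ring O] [Algebra ℂ O] [Superalgebra O] [SuperHopfAlgebra O] {n : ℕ}

/-- `N(z)` in `D_θ + A = D_θ + θ M(z) + N(z)`. -/
def partN (A : O →ₗ[ℂ] SuperRat n) : O →ₗ[ℂ] RatGrassmann n := Theta.bodyMap _ ∘ₗ A

/-- `M(z)` in `D_θ + A = D_θ + θ M(z) + N(z)`. -/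
def partM (A : O →ₗ[ℂ] SuperRat n) : O →ₗ[ℂ] RatGrassmann n := Theta.coeffMap _ ∘ₗ A

/-- A `θ`-independent element of `𝔤(z)` or `G(z)` seen over `S(z)[θ]`. -/
def liftTheta (f : O →ₗ[ℂ] RatGrassmann n) : O →ₗ[ℂ] SuperRat n := Theta.incl _ ∘ₗ f

/-- `θ f`. -/
def thetaTimes (f : O →ₗ[ℂ] RatGrassmann n) : O →ₗ[ℂ] SuperRat n := Theta.thetaMul _ ∘ₗ f

/-- The element `(1 - θ R(z)) U(z)`. -/
def factored (R U : O →ₗ[ℂ] RatGrassmann n) : O →ₗ[ℂ] SuperRat n :=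
  (unitPoint O (SuperRat n) - thetaTimes R) ⋆ₛ liftTheta U

/-- The coefficient `½[N, N] + M` of the connection `∇̃ = ∂_z + ½[N, N] + M`. -/
def reduced (A : O →ₗ[ℂ] SuperRat n) : O →ₗ[ℂ] RatGrassmann n :=
  (1 / 2 : ℂ) • superBracket (partN A) (partN A) + partM A

/-- The connection `D_θ + A` is `Ẑ`-twisted: it is equivalent to `D_θ + θ Ẑ` under the gauge action
of `G(z, θ)`. -/
def IsTwisted (Z : O →ₗ[ℂ] Grassmann n) (A : O →ₗ[ℂ] SuperRat n) : Prop :=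
  ∃ g ∈ points O (SuperRat n), gaugeTransform (Dtheta n) g A = thetaTimes (constIncl n ∘ₗ Z)

/-- The meromorphic connection `∂_z + B` on `ℙ¹` is gauge equivalent, under `G(z)`, to the constant
connection `∂_z + Ẑ`. -/
def IsGaugeConst (Z : O →ₗ[ℂ] Grassmann n) (B : O →ₗ[ℂ] RatGrassmann n) : Prop :=
  ∃ U ∈ points O (RatGrassmann n), gaugeTransform (dz n) U B = constIncl n ∘ₗ Z

end Connections

/-! ## Superopers and Miura superopers -/

/-- The colours of the nodes of a super Dynkin diagram. -/
inductive NodeColor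
  | white
  | grey
  | black

section Miura

variable (O : Type*) [Ring O] [Algebra ℂ O] [Superalgebra O] [SuperHopfAlgebra O]

/-- The Lie subsuperalgebra of `𝔤` generated by a set of elements. -/
def lieClosure {O : Type*} [Ring O] [Algebra ℂ O] [Superalgebra O] [SuperHopfAlgebra O]
    (s : Set (O →ₗ[ℂ] ℂ)) : Submodule ℂ (O →ₗ[ℂ] ℂ) :=
  sInf {W | s ⊆ W ∧ ∀ f ∈ W, ∀ h ∈ W, superBracket f h ∈ W}

/-- Chevalley generators `e_i`, `f_i`, `α̌_i` of the Lie superalgebra `𝔤` of `G`, for a Dynkin diagram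
with white, grey and black nodes. -/
structure ChevalleyGenerators where
  rank : ℕ
  color : Fin rank → NodeColor
  cartan : Matrix (Fin rank) (Fin rank) ℂ
  e : Fin rank → O →ₗ[ℂ] ℂ
  f : Fin rank → O →ₗ[ℂ] ℂ
  coroot : Fin rank → O →ₗ[ℂ] ℂ
  e_even : ∀ i, color i = .white → e i ∈ lieEven O ℂ
  f_even : ∀ i, color i = .white → f i ∈ lieEven O ℂ
  e_odd : ∀ i, color i ≠ .white → e i ∈ lieOdd O ℂ
  f_odd : ∀ i, color i ≠ .white → f i ∈ lieOdd O ℂ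
  coroot_even : ∀ i, coroot i ∈ lieEven O ℂ
  coroot_ne_zero : ∀ i, coroot i ≠ 0
  cartan_diag : ∀ i, color i ≠ .grey → cartan i i = 2
  cartan_grey : ∀ i, color i = .grey → cartan i i = 0
  bracket_coroot : ∀ i j, superBracket (coroot i) (coroot j) = 0
  bracket_coroot_e : ∀ i j, superBracket (coroot i) (e j) = cartan i j • e j
  bracket_coroot_f : ∀ i j, superBracket (coroot i) (f j) = -(cartan i j • f j)
  bracket_e_f : ∀ i j, superBracket (e i) (f j) = if i = j then coroot i else 0
  generate : lieClosure (Set.range e ∪ Set.range f) = lie O ℂ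

variable {O}

/-- The Borel subalgebra `𝔟₋`, generated by the `f_i` and the `α̌_i`. -/
def ChevalleyGenerators.borelMinus (C : ChevalleyGenerators O) : Submodule ℂ (O →ₗ[ℂ] ℂ) :=
  lieClosure (Set.range C.f ∪ Set.range C.coroot)

/-- The Borel subalgebra `𝔟₊`, generated by the `e_i` and the `α̌_i`. -/
def ChevalleyGenerators.borelPlus (C : ChevalleyGenerators O) : Submodule ℂ (O →ₗ[ℂ] ℂ) :=
  lieClosure (Set.range C.e ∪ Set.range C.coroot)

/-- The element `a ξ` of `R ⊗ 𝔤`, for `a ∈ R` and `ξ ∈ 𝔤`. -/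
def scaled {R : Type*} [Ring R] [Algebra ℂ R] (a : R) (ξ : O →ₗ[ℂ] ℂ) : O →ₗ[ℂ] R :=
  LinearMap.toSpanSingleton ℂ R a ∘ₗ ξ

/-- `R ⊗ W`, for a subspace `W` of `𝔤`. -/
def extendScalars (R : Type*) [Ring R] [Algebra ℂ R] (W : Submodule ℂ (O →ₗ[ℂ] ℂ)) :
    Submodule ℂ (O →ₗ[ℂ] R) :=
  Submodule.span ℂ {F | ∃ (a : R), ∃ ξ ∈ W, F = scaled a ξ}

/-- `B` is the form of a superoper in a trivialization of the `B₋`-bundle: `B = ∑ a_i e_i + b`, with `a_i`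
nonzero of parity opposite to that of `e_i`, and `b` odd with values in `𝔟₋`. -/
def IsSuperoperForm (C : ChevalleyGenerators O) {n : ℕ} (B : O →ₗ[ℂ] SuperRat n) : Prop :=
  ∃ (a : Fin C.rank → SuperRat n) (b : O →ₗ[ℂ] SuperRat n),
    (∀ i, a i ≠ 0) ∧
    (∀ i, C.color i = .white → IsOdd (a i)) ∧ (∀ i, C.color i ≠ .white → IsEven (a i)) ∧
    b ∈ lieOdd O (SuperRat n) ∧ b ∈ extendScalars (SuperRat n) C.borelMinus ∧
    B = ∑ i, scaled (a i) (C.e i) + b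

/-- The meromorphic connection `D_θ + A` on the super Riemann sphere underlies a Miura `G`-superoper:
it is a superoper with respect to some `B₋`-reduction of the bundle, and it preserves some
`B₊`-reduction. A reduction is given over an open dense subset by the trivializations compatible
with it, that is, by the gauge transformations `g` and `k`. -/
def IsMiuraSuperoper (C : ChevalleyGenerators O) {n : ℕ} (A : O →ₗ[ℂ] SuperRat n) : Prop :=
  A ∈ lieOdd O (SuperRat n) ∧
  (∃ g ∈ points O (SuperRat n), IsSuperoperForm C (gaugeTransform (Dtheta n) g A)) ∧
  (∃ k ∈ points O (SuperRat n),
    gaugeTransform (Dtheta n) k A ∈ extendScalars (SuperRat n) C.borelPlus)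

end Miura

end

/-! ## Superalgebra preliminaries -/

section Prelim

variable {R : Type*} [Ring R] [Algebra ℂ R] [Superalgebra R]

/-! The points of `G` and the elements of `R ⊗ 𝔤` both lie in `Hom(O, R)`, which super convolution
makes into an associative superalgebra, and `Hom(O, R[θ])` is `Hom(O, R)[θ]`. Everything then
reduces to comparing coefficients of `θ`.

Write `g = a + θ b` and `A = N + θ M`. Since `D_θ (a + θ b) = b + θ ∂a` and `N` is odd, `A g + D_θ g
= (N a + b) + θ (M a - N b + ∂a)`. The inverse of `g` has the invertible body `a⁻¹`, so `g⁻¹ A g +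
g⁻¹ (D_θ g)` has no `θ`-free part exactly when `b = -N a`, that is, `g = (1 - θ N) a`. For this `g`
the coefficient of `θ` is `a⁻¹ ((N² + M) a + ∂a)`, the gauge transform of `∂ + N² + M` by `a`, and
`N² = ½ [N, N]`. These two computations are `gaugeTransform_thetaHom_body_iff` and
`gaugeTransform_thetaHom`. Because `D_θ + θ Ẑ` has no `θ`-free part, the twisted condition follows
by comparing coefficients of `θ`.

The remaining work is membership. That `(1 - θ N) U` is a point needs `G(R[θ])` closed under
products (`superConv_mem_points`), hence supercommutativity of `S(z)[θ]`. That `N²` lies in `𝔤(R)`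
(`superConv_self_mem_lie`) is read off from a product of two such points with independent odd
parameters. -/

@[simp] theorem par_par (a : R) : par R (par R a) = a := Superalgebra.parity_parity a

theorem evenProj_apply (a : R) : evenProj R a = (1 / 2 : ℂ) • (a + par R a) := rfl

theorem oddProj_apply (a : R) : oddProj R a = (1 / 2 : ℂ) • (a - par R a) := rfl

theorem par_evenProj (a : R) : par R (evenProj R a) = evenProj R a := by
  simp [evenProj_apply, add_comm]

theorem par_oddProj (a : R) : par R (oddProj R a) = -oddProj R a := by
  simp [oddProj_apply, ← smul_neg]

variable (R) in
/-- Supercommutativity, written for elements which need not be homogeneous. -/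
def SwapRule : Prop := ∀ a b : R, a * b = evenProj R b * a + oddProj R b * par R a

/-- The elements `b` that obey the rule against every `a` are closed under products, so for an
algebra given by generators the rule need only be checked on generators. -/
theorem swapRule_mul_right {b c : R}
    (hb : ∀ a : R, a * b = evenProj R b * a + oddProj R b * par R a)
    (hc : ∀ a : R, a * c = evenProj R c * a + oddProj R c * par R a) (a : R) :
    a * (b * c) = evenProj R (b * c) * a + oddProj R (b * c) * par R a := by
  have he : evenProj R (b * c) =
      evenProj R b * evenProj R c + oddProj R b * oddProj R c := by
    simp only [evenProj_apply, oddProj_apply, map_mul, smul_mul_smul_comm, mul_add, add_mul,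
      mul_sub, sub_mul]
    module
  have ho : oddProj R (b * c) =
      evenProj R b * oddProj R c + oddProj R b * evenProj R c := by
    simp only [evenProj_apply, oddProj_apply, map_mul, smul_mul_smul_comm, mul_add, add_mul,
      mul_sub, sub_mul]
    module
  have h1 := hc a
  have h2 := hc (par R a)
  rw [par_par] at h2
  rw [← mul_assoc, hb a, add_mul, mul_assoc, mul_assoc, h1, h2, he, ho]
  simp only [mul_add, add_mul, mul_assoc]
  abel

namespace Theta

@[simp] theorem par_body (x : Theta R) : (par (Theta R) x).body = par R x.body := rfl

@[simp] theorem par_coeff (x : Theta R) : (par (Theta R) x).coeff = -par R x.coeff := rfl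

/-- Since `θ` is odd, the even part of `θ b` is `θ` times the odd part of `b` and vice versa. With
this exchange each coefficient follows from the rule in `R`. -/
theorem swapRule (h : SwapRule R) : SwapRule (Theta R) := by
  intro a b
  have eb : (evenProj (Theta R) b).body = evenProj R b.body := rfl
  have ob : (oddProj (Theta R) b).body = oddProj R b.body := rfl
  have ec : (evenProj (Theta R) b).coeff = oddProj R b.coeff := by
    simp [evenProj_apply, oddProj_apply, sub_eq_add_neg]
  have oc : (oddProj (Theta R) b).coeff = evenProj R b.coeff := by
    simp [evenProj_apply, oddProj_apply, sub_eq_add_neg]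
  ext
  · simpa [eb, ob] using h a.body b.body
  · simp only [mul_coeff, add_coeff, eb, ob, ec, oc, par_body, par_coeff, par_evenProj,
      par_oddProj]
    rw [h a.coeff b.body, h (par R a.body) b.coeff, par_par, neg_mul_neg]
    abel

end Theta

end Prelim

/-! ### Supercommutativity of `S` and `S(z)` -/

section Grassmann

variable {n : ℕ}

@[simp] theorem par_ι (v : Fin n → ℂ) :
    par (Grassmann n) (ExteriorAlgebra.ι ℂ v) = -ExteriorAlgebra.ι ℂ v :=
  CliffordAlgebra.involute_ι v

theorem mul_ι_eq_ι_mul_par (v : Fin n → ℂ) (a : Grassmann n) :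
    a * ExteriorAlgebra.ι ℂ v = ExteriorAlgebra.ι ℂ v * par (Grassmann n) a := by
  induction a using ExteriorAlgebra.induction with
  | algebraMap r => rw [AlgHom.commutes]; exact Algebra.commutes r _
  | ι w =>
    rw [par_ι, mul_neg]
    exact eq_neg_of_add_eq_zero_left (ExteriorAlgebra.ι_add_mul_swap w v)
  | mul a b ha hb => rw [mul_assoc, hb, ← mul_assoc, ha, map_mul, mul_assoc]
  | add a b ha hb => rw [add_mul, ha, hb, map_add, mul_add]

theorem Grassmann.swapRule (n : ℕ) : SwapRule (Grassmann n) := by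
  intro a b
  induction b using ExteriorAlgebra.induction generalizing a with
  | algebraMap r =>
    have he : evenProj (Grassmann n) (algebraMap ℂ _ r) = algebraMap ℂ _ r := by
      rw [evenProj_apply, AlgHom.commutes]; module
    have ho : oddProj (Grassmann n) (algebraMap ℂ _ r) = 0 := by
      rw [oddProj_apply, AlgHom.commutes, sub_self, smul_zero]
    rw [he, ho, zero_mul, add_zero]
    exact (Algebra.commutes r a).symm
  | ι v =>
    have he : evenProj (Grassmann n) (ExteriorAlgebra.ι ℂ v) = 0 := by
      rw [evenProj_apply, par_ι, add_neg_cancel, smul_zero]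
    have ho : oddProj (Grassmann n) (ExteriorAlgebra.ι ℂ v) = ExteriorAlgebra.ι ℂ v := by
      rw [oddProj_apply, par_ι]; module
    rw [he, ho, zero_mul, zero_add, mul_ι_eq_ι_mul_par]
  | mul b c hb hc => exact swapRule_mul_right hb hc a
  | add b c hb hc =>
    rw [mul_add, hb, hc, map_add, map_add, add_mul, add_mul]; abel

theorem RatGrassmann.par_tmul (f : RatFunc ℂ) (s : Grassmann n) :
    par (RatGrassmann n) (f ⊗ₜ[ℂ] s) = f ⊗ₜ[ℂ] par (Grassmann n) s :=
  Algebra.TensorProduct.map_tmul _ _ _ _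

/-- The factor `ℂ(z)` is commutative and purely even, so the signs come from the Grassmann factor
alone. -/
theorem RatGrassmann.swapRule (n : ℕ) : SwapRule (RatGrassmann n) := by
  intro a b
  induction b using TensorProduct.induction_on with
  | zero => simp
  | add b c hb hc => rw [mul_add, hb, hc, map_add, map_add, add_mul, add_mul]; abel
  | tmul g t =>
    have he : evenProj (RatGrassmann n) (g ⊗ₜ[ℂ] t) = g ⊗ₜ[ℂ] evenProj (Grassmann n) t := by
      rw [evenProj_apply, evenProj_apply, RatGrassmann.par_tmul, ← TensorProduct.tmul_add,
        TensorProduct.tmul_smul]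
    have ho : oddProj (RatGrassmann n) (g ⊗ₜ[ℂ] t) = g ⊗ₜ[ℂ] oddProj (Grassmann n) t := by
      rw [oddProj_apply, oddProj_apply, RatGrassmann.par_tmul, ← TensorProduct.tmul_sub,
        TensorProduct.tmul_smul]
    rw [he, ho]
    induction a using TensorProduct.induction_on with
    | zero => simp
    | add a c ha hc => rw [add_mul, ha, hc, map_add, mul_add, mul_add]; abel
    | tmul f s =>
      rw [RatGrassmann.par_tmul]
      simp only [Algebra.TensorProduct.tmul_mul_tmul]
      rw [Grassmann.swapRule n s t, TensorProduct.tmul_add, mul_comm f g]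

end Grassmann

/-! ## The convolution superalgebra -/

section Conv

variable {O : Type*} [Ring O] [Algebra ℂ O]
variable {R : Type*} [Ring R] [Algebra ℂ R]

/-- Convolution without signs. -/
def conv [Coalgebra ℂ O] (f h : O →ₗ[ℂ] R) : O →ₗ[ℂ] R :=
  LinearMap.mul' ℂ R ∘ₗ TensorProduct.map f h ∘ₗ Coalgebra.comul

/-! ### Convolution without signs -/

section Plain

variable [Coalgebra ℂ O]

/-- `conv` unfolds to the product on `WithConv`, so the monoid laws transfer from there. -/
theorem conv_assoc (f h k : O →ₗ[ℂ] R) : conv (conv f h) k = conv f (conv h k) :=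
  congrArg WithConv.ofConv
    (mul_assoc (WithConv.toConv f) (WithConv.toConv h) (WithConv.toConv k))

theorem conv_unitPoint (f : O →ₗ[ℂ] R) : conv f (unitPoint O R) = f :=
  congrArg WithConv.ofConv (mul_one (WithConv.toConv f))

theorem unitPoint_conv (f : O →ₗ[ℂ] R) : conv (unitPoint O R) f = f :=
  congrArg WithConv.ofConv (one_mul (WithConv.toConv f))

theorem add_conv (f f' h : O →ₗ[ℂ] R) : conv (f + f') h = conv f h + conv f' h := by
  simp only [conv, TensorProduct.map_add_left, LinearMap.add_comp, LinearMap.comp_add]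

theorem conv_add (f h h' : O →ₗ[ℂ] R) : conv f (h + h') = conv f h + conv f h' := by
  simp only [conv, TensorProduct.map_add_right, LinearMap.add_comp, LinearMap.comp_add]

theorem smul_conv (c : ℂ) (f h : O →ₗ[ℂ] R) : conv (c • f) h = c • conv f h := by
  simp only [conv, TensorProduct.map_smul_left, LinearMap.smul_comp, LinearMap.comp_smul]

theorem conv_smul (c : ℂ) (f h : O →ₗ[ℂ] R) : conv f (c • h) = c • conv f h := by
  simp only [conv, TensorProduct.map_smul_right, LinearMap.smul_comp, LinearMap.comp_smul]

theorem neg_conv (f h : O →ₗ[ℂ] R) : conv (-f) h = -conv f h := by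
  rw [← neg_one_smul ℂ f, smul_conv]; module

theorem conv_neg (f h : O →ₗ[ℂ] R) : conv f (-h) = -conv f h := by
  rw [← neg_one_smul ℂ h, conv_smul]; module

theorem algHom_comp_conv {T : Type*} [Ring T] [Algebra ℂ T] (φ : R →ₐ[ℂ] T)
    (f h : O →ₗ[ℂ] R) :
    φ.toLinearMap ∘ₗ conv f h = conv (φ.toLinearMap ∘ₗ f) (φ.toLinearMap ∘ₗ h) :=
  LinearMap.algHom_comp_convMul_distrib φ (WithConv.toConv f) (WithConv.toConv h)

@[simp] theorem unitPoint_apply (x : O) :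
    unitPoint O R x = algebraMap ℂ R (Coalgebra.counit x) := rfl

theorem algHom_comp_unitPoint {T : Type*} [Ring T] [Algebra ℂ T] (φ : R →ₐ[ℂ] T) :
    φ.toLinearMap ∘ₗ unitPoint O R = unitPoint O T := by
  ext x; simp

end Plain

section CompPar

variable [Superalgebra O]

theorem comp_par_comp_par (f : O →ₗ[ℂ] R) :
    (f ∘ₗ (par O).toLinearMap) ∘ₗ (par O).toLinearMap = f := by
  ext x; simp

/-- The parity operator of `O` commutes with the comultiplication. -/
theorem conv_comp_par [SuperHopfAlgebra O] (f h : O →ₗ[ℂ] R) :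
    conv f h ∘ₗ (par O).toLinearMap =
      conv (f ∘ₗ (par O).toLinearMap) (h ∘ₗ (par O).toLinearMap) := by
  ext x
  simp [conv, SuperHopfAlgebra.comul_par, TensorProduct.map_comp]

end CompPar

/-! ### Linear maps `f + θ h` into `R[θ]` -/

section ThetaHom

variable [Superalgebra R]

/-- The linear map `f + θ h`. -/
def thetaHom (f h : O →ₗ[ℂ] R) : O →ₗ[ℂ] Theta R := Theta.incl R ∘ₗ f + Theta.thetaMul R ∘ₗ h

@[simp] theorem thetaHom_body (f h : O →ₗ[ℂ] R) (x : O) : (thetaHom f h x).body = f x := by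
  simp [thetaHom, Theta.incl, Theta.thetaMul]

@[simp] theorem thetaHom_coeff (f h : O →ₗ[ℂ] R) (x : O) : (thetaHom f h x).coeff = h x := by
  simp [thetaHom, Theta.incl, Theta.thetaMul]

theorem thetaHom_inj {f h f' h' : O →ₗ[ℂ] R} :
    thetaHom f h = thetaHom f' h' ↔ f = f' ∧ h = h' := by
  refine ⟨fun e => ⟨?_, ?_⟩, fun e => by rw [e.1, e.2]⟩
  · ext x; simpa using congrArg Theta.body (LinearMap.congr_fun e x)
  · ext x; simpa using congrArg Theta.coeff (LinearMap.congr_fun e x)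

theorem eq_thetaHom (F : O →ₗ[ℂ] Theta R) :
    F = thetaHom (Theta.bodyMap R ∘ₗ F) (Theta.coeffMap R ∘ₗ F) := by
  ext x <;> simp [Theta.bodyMap, Theta.coeffMap]

theorem thetaHom_add (f h f' h' : O →ₗ[ℂ] R) :
    thetaHom f h + thetaHom f' h' = thetaHom (f + f') (h + h') := by
  ext x <;> simp

theorem superDeriv_comp_thetaHom (D : R →ₗ[ℂ] R) (f h : O →ₗ[ℂ] R) :
    Theta.superDeriv D ∘ₗ thetaHom f h = thetaHom h (D ∘ₗ f) := by
  ext x <;> simp [Theta.superDeriv]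

end ThetaHom

variable [Superalgebra O] [Superalgebra R]

/-! ### Parity on `Hom(O, R)` and points over `R[θ]` -/

section Grading

@[simp] theorem homPar_apply (f : O →ₗ[ℂ] R) (x : O) : homPar f x = par R (f (par O x)) := rfl

theorem homPar_homPar (f : O →ₗ[ℂ] R) : homPar (homPar f) = f := by
  ext x; simp

theorem homEven_eq_self {f : O →ₗ[ℂ] R} (hf : homPar f = f) : homEven f = f := by
  rw [homEven, hf]; module

theorem homOdd_eq_zero {f : O →ₗ[ℂ] R} (hf : homPar f = f) : homOdd f = 0 := by
  rw [homOdd, hf, sub_self, smul_zero]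

theorem homEven_eq_zero {f : O →ₗ[ℂ] R} (hf : homPar f = -f) : homEven f = 0 := by
  rw [homEven, hf, add_neg_cancel, smul_zero]

theorem homOdd_eq_self {f : O →ₗ[ℂ] R} (hf : homPar f = -f) : homOdd f = f := by
  rw [homOdd, hf]; module

theorem homPar_eq_self_of_mem_points {g : O →ₗ[ℂ] R} (hg : g ∈ points O R) : homPar g = g := by
  ext x; simp [hg.2.2]

theorem homPar_add (f h : O →ₗ[ℂ] R) : homPar (f + h) = homPar f + homPar h := by
  ext x; simp

theorem homPar_smul (c : ℂ) (f : O →ₗ[ℂ] R) : homPar (c • f) = c • homPar f := by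
  ext x; simp

theorem homPar_neg (f : O →ₗ[ℂ] R) : homPar (-f) = -homPar f := by
  ext x; simp

theorem homEven_add (f h : O →ₗ[ℂ] R) : homEven (f + h) = homEven f + homEven h := by
  simp only [homEven, homPar_add]; module

theorem homOdd_add (f h : O →ₗ[ℂ] R) : homOdd (f + h) = homOdd f + homOdd h := by
  simp only [homOdd, homPar_add]; module

theorem homEven_smul (c : ℂ) (f : O →ₗ[ℂ] R) : homEven (c • f) = c • homEven f := by
  simp only [homEven, homPar_smul]; module

theorem homOdd_smul (c : ℂ) (f : O →ₗ[ℂ] R) : homOdd (c • f) = c • homOdd f := by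
  simp only [homOdd, homPar_smul]; module

theorem homEven_add_homOdd (f : O →ₗ[ℂ] R) : homEven f + homOdd f = f := by
  rw [homEven, homOdd]; module

theorem homPar_homEven (f : O →ₗ[ℂ] R) : homPar (homEven f) = homEven f := by
  rw [homEven, homPar_smul, homPar_add, homPar_homPar, add_comm]

theorem homPar_homOdd (f : O →ₗ[ℂ] R) : homPar (homOdd f) = -homOdd f := by
  rw [homOdd, homPar_smul, sub_eq_add_neg, homPar_add, homPar_neg, homPar_homPar]
  module

theorem homPar_comp_par (f : O →ₗ[ℂ] R) :
    homPar (f ∘ₗ (par O).toLinearMap) = homPar f ∘ₗ (par O).toLinearMap := rfl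

theorem evenProj_point {g : O →ₗ[ℂ] R} (hg : g ∈ points O R) (x : O) :
    g (evenProj O x) = evenProj R (g x) := by
  simp [evenProj_apply, hg.2.2]

theorem oddProj_point {g : O →ₗ[ℂ] R} (hg : g ∈ points O R) (x : O) :
    g (oddProj O x) = oddProj R (g x) := by
  simp [oddProj_apply, hg.2.2]

theorem superTensorMul_add_left (X X' Y : O ⊗[ℂ] O) :
    superTensorMul (X + X') Y = superTensorMul X Y + superTensorMul X' Y := by
  simp only [superTensorMul, map_add, add_mul]; abel

theorem superTensorMul_add_right (X Y Y' : O ⊗[ℂ] O) :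
    superTensorMul X (Y + Y') = superTensorMul X Y + superTensorMul X Y' := by
  simp only [superTensorMul, map_add, mul_add]; abel

/-- Multiplicativity of a product of points. On pure tensors one has to move `h b` past `g c` in
`R`; the resulting sign is the one built into `superTensorMul`, because points preserve parity. -/
theorem mul'_map_superTensorMul (hR : SwapRule R) {g h : O →ₗ[ℂ] R} (hg : g ∈ points O R)
    (hh : h ∈ points O R) (X Y : O ⊗[ℂ] O) :
    LinearMap.mul' ℂ R (TensorProduct.map g h (superTensorMul X Y)) =
      LinearMap.mul' ℂ R (TensorProduct.map g h X) *
        LinearMap.mul' ℂ R (TensorProduct.map g h Y) := by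
  induction X using TensorProduct.induction_on with
  | zero => simp [superTensorMul]
  | add X X' h1 h2 => rw [superTensorMul_add_left]; simp only [map_add, add_mul, h1, h2]
  | tmul a b =>
    induction Y using TensorProduct.induction_on with
    | zero => simp [superTensorMul]
    | add X X' h1 h2 => rw [superTensorMul_add_right]; simp only [map_add, mul_add, h1, h2]
    | tmul c d =>
      simp only [superTensorMul, TensorProduct.map_tmul, Algebra.TensorProduct.tmul_mul_tmul,
        map_add, LinearMap.mul'_apply, LinearMap.id_apply, AlgHom.toLinearMap_apply, hg.2.1,
        hh.2.1, evenProj_point hg, oddProj_point hg, hh.2.2]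
      rw [mul_assoc (g a) (h b), ← mul_assoc (h b) (g c), hR (h b) (g c)]
      noncomm_ring

theorem homPar_thetaHom (f h : O →ₗ[ℂ] R) :
    homPar (thetaHom f h) = thetaHom (homPar f) (-homPar h) := by
  ext x <;> simp

/-- A point over `R[θ]` is a point `f` over `R` together with a parity-reversing superderivation
along `f`. The sign `par R (f x)` appears when `θ` is moved to the left past `f x`. -/
theorem thetaHom_mem_points_iff {f h : O →ₗ[ℂ] R} :
    thetaHom f h ∈ points O (Theta R) ↔ f ∈ points O R ∧ h 1 = 0 ∧
      (∀ x y, h (x * y) = h x * f y + par R (f x) * h y) ∧ ∀ x, h (par O x) = -par R (h x) := by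
  simp only [points, Set.mem_ofPred_eq, Theta.ext_iff, thetaHom_body, thetaHom_coeff,
    Theta.one_body, Theta.one_coeff, Theta.mul_body, Theta.mul_coeff, Theta.par_body,
    Theta.par_coeff, forall_and]
  tauto

theorem thetaHom_zero_mem_points {U : O →ₗ[ℂ] R} (hU : U ∈ points O R) :
    thetaHom U 0 ∈ points O (Theta R) :=
  thetaHom_mem_points_iff.2 ⟨hU, by simp, by simp, by simp⟩

end Grading

/-! ### Super convolution: bilinearity, parity and associativity -/

variable [SuperHopfAlgebra O]

theorem homPar_eq_neg_of_mem_lieOdd {f : O →ₗ[ℂ] R} (hf : f ∈ lieOdd O R) : homPar f = -f := by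
  ext x; simp [hf.2]

theorem homPar_conv (f h : O →ₗ[ℂ] R) : homPar (conv f h) = conv (homPar f) (homPar h) := by
  rw [homPar, conv_comp_par, algHom_comp_conv]; rfl

theorem homPar_unitPoint : homPar (unitPoint O R) = unitPoint O R := by
  ext x; simp [SuperHopfAlgebra.counit_par]

theorem superConv_eq (f h : O →ₗ[ℂ] R) :
    f ⋆ₛ h = conv f (homEven h) + conv (f ∘ₗ (par O).toLinearMap) (homOdd h) := by
  simp only [superConv, conv, LinearMap.add_comp, LinearMap.comp_add]

theorem superConv_of_even (f : O →ₗ[ℂ] R) {h : O →ₗ[ℂ] R} (hh : homPar h = h) :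
    f ⋆ₛ h = conv f h := by
  rw [superConv_eq, homEven_eq_self hh, homOdd_eq_zero hh, conv, conv,
    TensorProduct.map_zero_right]
  simp

theorem superConv_unitPoint (f : O →ₗ[ℂ] R) : f ⋆ₛ unitPoint O R = f := by
  rw [superConv_of_even _ homPar_unitPoint, conv_unitPoint]

theorem unitPoint_superConv (f : O →ₗ[ℂ] R) : unitPoint O R ⋆ₛ f = f := by
  have h : unitPoint O R ∘ₗ (par O).toLinearMap = unitPoint O R := by
    ext x; simp [SuperHopfAlgebra.counit_par]
  rw [superConv_eq, h, unitPoint_conv, unitPoint_conv, homEven, homOdd]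
  module

theorem add_superConv (f f' h : O →ₗ[ℂ] R) : (f + f') ⋆ₛ h = f ⋆ₛ h + f' ⋆ₛ h := by
  simp only [superConv_eq, add_conv, LinearMap.add_comp]
  abel

theorem smul_superConv (c : ℂ) (f h : O →ₗ[ℂ] R) : (c • f) ⋆ₛ h = c • (f ⋆ₛ h) := by
  simp only [superConv_eq, smul_conv, LinearMap.smul_comp, smul_add]

theorem neg_superConv (f h : O →ₗ[ℂ] R) : (-f) ⋆ₛ h = -(f ⋆ₛ h) := by
  rw [← neg_one_smul ℂ f, smul_superConv]; module

theorem superConv_add (f h h' : O →ₗ[ℂ] R) : f ⋆ₛ (h + h') = f ⋆ₛ h + f ⋆ₛ h' := by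
  simp only [superConv_eq, homEven_add, homOdd_add, conv_add]
  abel

theorem superConv_smul (c : ℂ) (f h : O →ₗ[ℂ] R) : f ⋆ₛ (c • h) = c • (f ⋆ₛ h) := by
  simp only [superConv_eq, homEven_smul, homOdd_smul, conv_smul, smul_add]

theorem superConv_neg (f h : O →ₗ[ℂ] R) : f ⋆ₛ (-h) = -(f ⋆ₛ h) := by
  rw [← neg_one_smul ℂ h, superConv_smul]; module

theorem superConv_zero (f : O →ₗ[ℂ] R) : f ⋆ₛ 0 = 0 := by
  simpa using superConv_smul (0 : ℂ) f 0

theorem zero_superConv (f : O →ₗ[ℂ] R) : 0 ⋆ₛ f = 0 := by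
  simpa using smul_superConv (0 : ℂ) 0 f

/-- The sign `(-1)^|x₁|` is absorbed into `f` by precomposing with parity. Super convolution thereby
reduces to the unsigned one on homogeneous right factors. -/
theorem superConv_of_odd (f : O →ₗ[ℂ] R) {h : O →ₗ[ℂ] R} (hh : homPar h = -h) :
    f ⋆ₛ h = conv (f ∘ₗ (par O).toLinearMap) h := by
  have h0 : conv f (0 : O →ₗ[ℂ] R) = 0 := by simpa using conv_smul (0 : ℂ) f 0
  rw [superConv_eq, homEven_eq_zero hh, homOdd_eq_self hh, h0, zero_add]

theorem homPar_superConv (f h : O →ₗ[ℂ] R) : homPar (f ⋆ₛ h) = homPar f ⋆ₛ homPar h := by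
  rw [← homEven_add_homOdd h, superConv_add, homPar_add, homPar_add, superConv_add,
    homPar_homEven, homPar_homOdd, superConv_neg, superConv_of_even _ (homPar_homEven h),
    superConv_of_even _ (homPar_homEven h), superConv_of_odd _ (homPar_homOdd h),
    superConv_of_odd _ (homPar_homOdd h), homPar_conv, homPar_conv, homPar_homEven,
    homPar_homOdd, conv_neg, homPar_comp_par]

/-- Associativity of super convolution. -/
theorem superConv_assoc (f h k : O →ₗ[ℂ] R) : f ⋆ₛ h ⋆ₛ k = f ⋆ₛ (h ⋆ₛ k) := by
  -- By bilinearity `h` and `k` may be taken homogeneous. In each of the four cases the signs become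
  -- precompositions with parity and `conv_assoc` applies; in the odd-odd case two of them cancel on
  -- `f`.
  have hee : ∀ {u v : O →ₗ[ℂ] R}, homPar u = u → homPar v = v → f ⋆ₛ u ⋆ₛ v = f ⋆ₛ (u ⋆ₛ v) := by
    intro u v hu hv
    have h1 : homPar (conv u v) = conv u v := by rw [homPar_conv, hu, hv]
    rw [superConv_of_even _ hv, superConv_of_even _ hu, superConv_of_even _ hv,
      superConv_of_even _ h1, conv_assoc]
  have hoe : ∀ {u v : O →ₗ[ℂ] R}, homPar u = -u → homPar v = v → f ⋆ₛ u ⋆ₛ v = f ⋆ₛ (u ⋆ₛ v) := by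
    intro u v hu hv
    have h1 : homPar (conv u v) = -conv u v := by rw [homPar_conv, hu, hv, neg_conv]
    rw [superConv_of_even _ hv, superConv_of_odd _ hu, superConv_of_even _ hv,
      superConv_of_odd _ h1, conv_assoc]
  have heo : ∀ {u v : O →ₗ[ℂ] R}, homPar u = u → homPar v = -v → f ⋆ₛ u ⋆ₛ v = f ⋆ₛ (u ⋆ₛ v) := by
    intro u v hu hv
    have h1 : homPar (conv (u ∘ₗ (par O).toLinearMap) v) =
        -conv (u ∘ₗ (par O).toLinearMap) v := by
      rw [homPar_conv, homPar_comp_par, hu, hv, conv_neg]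
    rw [superConv_of_odd _ hv, superConv_of_even _ hu, superConv_of_odd _ hv,
      superConv_of_odd _ h1, conv_comp_par, conv_assoc]
  have hoo : ∀ {u v : O →ₗ[ℂ] R}, homPar u = -u → homPar v = -v →
      f ⋆ₛ u ⋆ₛ v = f ⋆ₛ (u ⋆ₛ v) := by
    intro u v hu hv
    have h1 : homPar (conv (u ∘ₗ (par O).toLinearMap) v) =
        conv (u ∘ₗ (par O).toLinearMap) v := by
      rw [homPar_conv, homPar_comp_par, hu, hv, conv_neg, LinearMap.neg_comp, neg_conv, neg_neg]
    rw [superConv_of_odd _ hv, superConv_of_odd _ hu, superConv_of_odd _ hv,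
      superConv_of_even _ h1, conv_comp_par, comp_par_comp_par, conv_assoc]
  rw [← homEven_add_homOdd h, ← homEven_add_homOdd k]
  simp only [superConv_add, add_superConv]
  rw [hee (homPar_homEven h) (homPar_homEven k), hoe (homPar_homOdd h) (homPar_homEven k),
    heo (homPar_homEven h) (homPar_homOdd k), hoo (homPar_homOdd h) (homPar_homOdd k)]

/-! ## Inverses and products of points -/

variable (O) in
-- Conjugating the antipode by parity gives another left convolution inverse of the identity, and
-- such an inverse is unique.
theorem homPar_antipode :
    homPar (SuperHopfAlgebra.antipode : O →ₗ[ℂ] O) = SuperHopfAlgebra.antipode := by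
  have hid : homPar (LinearMap.id : O →ₗ[ℂ] O) = LinearMap.id := by ext x; simp
  have hl : conv SuperHopfAlgebra.antipode LinearMap.id = unitPoint O O :=
    SuperHopfAlgebra.antipode_left
  have hr : conv LinearMap.id SuperHopfAlgebra.antipode = unitPoint O O :=
    SuperHopfAlgebra.antipode_right
  have hl' := congrArg homPar hl
  rw [homPar_conv, hid, homPar_unitPoint] at hl'
  rw [← conv_unitPoint (homPar _), ← hr, ← conv_assoc, hl', unitPoint_conv]

theorem homPar_pointInv {g : O →ₗ[ℂ] R} (hg : g ∈ points O R) :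
    homPar (pointInv g) = pointInv g := by
  ext x
  have h := LinearMap.congr_fun (homPar_antipode O) x
  rw [homPar_apply] at h
  rw [homPar_apply, pointInv, LinearMap.comp_apply, LinearMap.comp_apply, ← hg.2.2, h]

/-- A point of `G` as a homomorphism of algebras. -/
def pointAlgHom {g : O →ₗ[ℂ] R} (hg : g ∈ points O R) : O →ₐ[ℂ] R :=
  AlgHom.ofLinearMap g hg.1 hg.2.1

/-- This is the antipode axiom pushed forward along the algebra homomorphism `g`; no sign enters
because `pointInv g` is even. -/
theorem superConv_pointInv {g : O →ₗ[ℂ] R} (hg : g ∈ points O R) :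
    g ⋆ₛ pointInv g = unitPoint O R := by
  have hr : conv LinearMap.id SuperHopfAlgebra.antipode = unitPoint O O :=
    SuperHopfAlgebra.antipode_right
  rw [superConv_of_even _ (homPar_pointInv hg),
    ← algHom_comp_unitPoint (pointAlgHom hg), ← hr, algHom_comp_conv]
  rfl

/-- The single identity `g ⋆ g⁻¹ = 1` suffices: multiply on the left by `g`. -/
theorem superConv_left_cancel {g : O →ₗ[ℂ] R} (hg : g ∈ points O R) {f : O →ₗ[ℂ] R} :
    pointInv g ⋆ₛ f = 0 ↔ f = 0 := by
  refine ⟨fun h => ?_, fun h => by rw [h, superConv_zero]⟩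
  rw [← unitPoint_superConv f, ← superConv_pointInv hg, superConv_assoc, h, superConv_zero]

theorem superConv_right_cancel {g : O →ₗ[ℂ] R} (hg : g ∈ points O R) {f h : O →ₗ[ℂ] R}
    (hfh : f ⋆ₛ g = h ⋆ₛ g) : f = h := by
  rw [← superConv_unitPoint f, ← superConv_unitPoint h, ← superConv_pointInv hg,
    ← superConv_assoc, hfh, superConv_assoc]

/-- `G(R)` is closed under multiplication. -/
theorem superConv_mem_points (hR : SwapRule R) {g h : O →ₗ[ℂ] R} (hg : g ∈ points O R)
    (hh : h ∈ points O R) : g ⋆ₛ h ∈ points O R := by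
  have hg' := homPar_eq_self_of_mem_points hg
  have hh' := homPar_eq_self_of_mem_points hh
  refine ⟨?_, fun x y => ?_, fun x => ?_⟩
  · rw [superConv_of_even _ hh']
    simp [conv, SuperHopfAlgebra.comul_one, hg.1, hh.1]
  · rw [superConv_of_even _ hh']
    simp only [conv, LinearMap.comp_apply, SuperHopfAlgebra.comul_mul]
    exact mul'_map_superTensorMul hR hg hh _ _
  · have h1 := homPar_superConv g h
    rw [hg', hh'] at h1
    have h2 := LinearMap.congr_fun h1 x
    rw [homPar_apply] at h2
    rw [← h2, par_par]

theorem unitPoint_mem_points : unitPoint O R ∈ points O R := by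
  refine ⟨?_, fun x y => ?_, fun x => ?_⟩
  · simp [SuperHopfAlgebra.counit_one]
  · simp [SuperHopfAlgebra.counit_mul]
  · simp [SuperHopfAlgebra.counit_par]

/-! ## Adjoining `θ` -/

theorem conv_thetaHom (f h f' h' : O →ₗ[ℂ] R) :
    conv (thetaHom f h) (thetaHom f' h') =
      thetaHom (conv f f') (conv h f' + conv ((par R).toLinearMap ∘ₗ f) h') := by
  ext x
  · simp only [conv, LinearMap.comp_apply, thetaHom_body]
    generalize (Coalgebra.comul x : O ⊗[ℂ] O) = t
    induction t using TensorProduct.induction_on with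
    | zero => simp
    | tmul a b => simp
    | add s t hs ht => simp only [map_add, Theta.add_body, hs, ht]
  · simp only [conv, LinearMap.comp_apply, thetaHom_coeff, LinearMap.add_apply]
    generalize (Coalgebra.comul x : O ⊗[ℂ] O) = t
    induction t using TensorProduct.induction_on with
    | zero => simp
    | tmul a b => simp
    | add s t hs ht => simp only [map_add, Theta.add_coeff, hs, ht]; abel

/-- Multiplication in `Hom(O, R[θ])`, which is `Hom(O, R)[θ]`. -/
theorem superConv_thetaHom (f h f' h' : O →ₗ[ℂ] R) :
    thetaHom f h ⋆ₛ thetaHom f' h' = thetaHom (f ⋆ₛ f') (h ⋆ₛ f' + homPar f ⋆ₛ h') := by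
  -- `θ h'` is even exactly when `h'` is odd, so the two parts of the coefficient trade places.
  have he : homEven (thetaHom f' h') = thetaHom (homEven f') (homOdd h') := by
    rw [homEven, homPar_thetaHom]
    ext x <;> simp [homEven, homOdd, sub_eq_add_neg]
  have ho : homOdd (thetaHom f' h') = thetaHom (homOdd f') (homEven h') := by
    rw [homOdd, homPar_thetaHom]
    ext x <;> simp [homEven, homOdd, sub_eq_add_neg]
  have hp : thetaHom f h ∘ₗ (par O).toLinearMap =
      thetaHom (f ∘ₗ (par O).toLinearMap) (h ∘ₗ (par O).toLinearMap) := by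
    ext x <;> simp
  have hq : homPar f ∘ₗ (par O).toLinearMap = (par R).toLinearMap ∘ₗ f := by
    ext x; simp
  rw [superConv_eq, he, ho, hp, conv_thetaHom, conv_thetaHom, thetaHom_add, thetaHom_inj]
  refine ⟨(superConv_eq f f').symm, ?_⟩
  rw [superConv_eq h f', superConv_eq (homPar f) h', hq]
  change _ = _ + (conv ((par R).toLinearMap ∘ₗ f ∘ₗ (par O).toLinearMap) _ + _)
  abel

theorem lieOdd_apply_one {N : O →ₗ[ℂ] R} (hN : N ∈ lieOdd O R) : N 1 = 0 := by
  have h := hN.1 1 1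
  rw [mul_one, SuperHopfAlgebra.counit_one, one_smul] at h
  exact left_eq_add.mp h

/-- `1 - θ N` is a point of `G`. -/
theorem thetaHom_unitPoint_neg_mem_points {N : O →ₗ[ℂ] R} (hN : N ∈ lieOdd O R) :
    thetaHom (unitPoint O R) (-N) ∈ points O (Theta R) := by
  refine thetaHom_mem_points_iff.2 ⟨unitPoint_mem_points, ?_, fun x y => ?_, fun x => ?_⟩
  · simp [lieOdd_apply_one hN]
  · simp only [LinearMap.neg_apply, hN.1 x y, unitPoint_apply, AlgHom.commutes, neg_mul,
      mul_neg, ← Algebra.commutes _ (N x), ← Algebra.smul_def]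
    abel
  · simp [hN.2]

theorem thetaHom_zero_mem_lieOdd {N : O →ₗ[ℂ] R} (hN : N ∈ lieOdd O R) :
    thetaHom N 0 ∈ lieOdd O (Theta R) := by
  refine ⟨fun x y => ?_, fun x => ?_⟩
  · ext <;> simp [hN.1 x y]
  · ext <;> simp [hN.2]

theorem one_sub_theta_superConv (N U : O →ₗ[ℂ] R) :
    thetaHom (unitPoint O R) (-N) ⋆ₛ thetaHom U 0 = thetaHom U (-(N ⋆ₛ U)) := by
  rw [superConv_thetaHom, unitPoint_superConv, neg_superConv, superConv_zero, add_zero]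

/-- `(1 - θ N) U` is a point of `G`. -/
theorem thetaHom_neg_superConv_mem_points (hR : SwapRule R) {N U : O →ₗ[ℂ] R}
    (hN : N ∈ lieOdd O R) (hU : U ∈ points O R) :
    thetaHom U (-(N ⋆ₛ U)) ∈ points O (Theta R) := by
  rw [← one_sub_theta_superConv]
  exact superConv_mem_points (Theta.swapRule hR) (thetaHom_unitPoint_neg_mem_points hN)
    (thetaHom_zero_mem_points hU)

/-- The square of an odd element of `𝔤(R)` lies in `𝔤(R)`: compare coefficients in the point
`(1 - θ' N)(1 - θ N)` over `R[θ][θ']`. -/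
theorem superConv_self_mem_lie (hR : SwapRule R) {N : O →ₗ[ℂ] R} (hN : N ∈ lieOdd O R) :
    N ⋆ₛ N ∈ lie O R := by
  intro x y
  -- The point has body `1 - θ N`, and its `θ'`-coefficient is `-N (1 - θ N)`, which satisfies a
  -- Leibniz rule along that body.
  have h := (thetaHom_mem_points_iff.1 (thetaHom_neg_superConv_mem_points (Theta.swapRule hR)
    (thetaHom_zero_mem_lieOdd hN) (thetaHom_unitPoint_neg_mem_points hN))).2.2.1 x y
  rw [superConv_thetaHom, homPar_eq_neg_of_mem_lieOdd hN, superConv_neg, neg_superConv, neg_neg,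
    superConv_unitPoint, zero_superConv, zero_add] at h
  -- In the coefficient of `θ` the two mixed terms `± par (N x) * N y` cancel, leaving the Leibniz
  -- rule for `N ⋆ N`.
  have h' := congrArg Theta.coeff h
  simp only [LinearMap.neg_apply, Theta.neg_coeff, thetaHom_coeff, Theta.add_coeff,
    Theta.mul_coeff, thetaHom_body, Theta.par_body, Theta.par_coeff,
    unitPoint_apply, AlgHom.commutes, map_neg, neg_neg, neg_mul, mul_neg,
    ← Algebra.commutes _ ((N ⋆ₛ N) x), ← Algebra.smul_def] at h'
  rw [← neg_inj, h']
  abel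

theorem superConv_self_mem_lieEven (hR : SwapRule R) {N : O →ₗ[ℂ] R} (hN : N ∈ lieOdd O R) :
    N ⋆ₛ N ∈ lieEven O R := by
  refine ⟨superConv_self_mem_lie hR hN, fun x => ?_⟩
  have h := LinearMap.congr_fun (homPar_superConv N N) (par O x)
  rw [homPar_eq_neg_of_mem_lieOdd hN, superConv_neg, neg_superConv, neg_neg, homPar_apply,
    par_par] at h
  exact h

/-- For odd `N` the sign in the superbracket turns the commutator into `2 N ⋆ N`. -/
theorem superBracket_self {N : O →ₗ[ℂ] R} (hN : N ∈ lieOdd O R) :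
    (1 / 2 : ℂ) • superBracket N N = N ⋆ₛ N := by
  have hN' := homPar_eq_neg_of_mem_lieOdd hN
  rw [superBracket, homEven_eq_zero hN', homOdd_eq_self hN', hN', zero_superConv, superConv_neg]
  module

theorem thetaHom_mem_lieOdd_iff {N M : O →ₗ[ℂ] R} :
    thetaHom N M ∈ lieOdd O (Theta R) ↔ N ∈ lieOdd O R ∧ M ∈ lieEven O R := by
  simp only [lieOdd, lieEven, lie, Submodule.mem_mk, AddSubmonoid.mem_mk, AddSubsemigroup.mem_mk,
    Set.mem_ofPred_eq, Theta.ext_iff, thetaHom_body, thetaHom_coeff, Theta.add_body,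
    Theta.add_coeff, Theta.smul_body, Theta.smul_coeff, Theta.par_body, Theta.par_coeff,
    Theta.neg_body, Theta.neg_coeff, forall_and, neg_inj]
  tauto

/-! ## Gauge transformations over `R[θ]` -/

/-- With `g⁻¹` factored out, vanishing of the body becomes a question about `A g + D g` alone. -/
theorem gaugeTransform_eq (D : R →ₗ[ℂ] R) (g A : O →ₗ[ℂ] R) :
    gaugeTransform D g A = pointInv g ⋆ₛ (A ⋆ₛ g + D ∘ₗ g) := by
  rw [gaugeTransform, superConv_assoc, superConv_add]

/-- Inversion is precomposition with the antipode, hence acts on each coefficient separately. In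
particular the body of the inverse is the inverse of the body. -/
theorem pointInv_thetaHom (a b : O →ₗ[ℂ] R) :
    pointInv (thetaHom a b) = thetaHom (pointInv a) (pointInv b) := by
  ext x <;> simp [pointInv]

/-- The `θ`-independent part of a gauge transform of `D_θ + N + θ M` vanishes only for gauge
transformations by `(1 - θ N) a`. -/
theorem gaugeTransform_thetaHom_body_iff (D : R →ₗ[ℂ] R) {N M a b : O →ₗ[ℂ] R}
    (ha : a ∈ points O R) :
    (∃ B, gaugeTransform (Theta.superDeriv D) (thetaHom a b) (thetaHom N M) = thetaHom 0 B) ↔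
      b = -(N ⋆ₛ a) := by
  rw [gaugeTransform_eq, superDeriv_comp_thetaHom, superConv_thetaHom, thetaHom_add,
    pointInv_thetaHom, superConv_thetaHom]
  simp only [thetaHom_inj, exists_and_left, exists_eq', and_true]
  rw [superConv_left_cancel ha, add_comm, add_eq_zero_iff_eq_neg]

/-- The choice of coefficient makes the body of `A g + D_θ g` zero, so only the body `U⁻¹` of the
inverse contributes. The term `N ⋆ N` arises from `homPar N ⋆ (-(N ⋆ U))`, the two minus signs
cancelling. -/
theorem gaugeTransform_thetaHom (D : R →ₗ[ℂ] R) {N M U : O →ₗ[ℂ] R} (hN : homPar N = -N)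
    (hU : U ∈ points O R) :
    gaugeTransform (Theta.superDeriv D) (thetaHom U (-(N ⋆ₛ U))) (thetaHom N M) =
      thetaHom 0 (gaugeTransform D U (N ⋆ₛ N + M)) := by
  rw [gaugeTransform_eq, gaugeTransform_eq, superDeriv_comp_thetaHom, superConv_thetaHom,
    thetaHom_add, pointInv_thetaHom, superConv_thetaHom, thetaHom_inj, homPar_pointInv hU, hN,
    neg_superConv, superConv_neg, neg_neg, add_neg_cancel, superConv_zero, superConv_zero,
    zero_add, add_superConv, superConv_assoc N N U, add_comm (M ⋆ₛ U)]
  exact ⟨rfl, rfl⟩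

end Conv

/-! ## Meromorphic superconnections -/

section Connections

variable {O : Type*} [Ring O] [Algebra ℂ O] {n : ℕ}

theorem thetaTimes_eq (B : O →ₗ[ℂ] RatGrassmann n) : thetaTimes B = thetaHom 0 B := by
  rw [thetaTimes, thetaHom, LinearMap.comp_zero, zero_add]

theorem liftTheta_eq (B : O →ₗ[ℂ] RatGrassmann n) : liftTheta B = thetaHom B 0 := by
  rw [liftTheta, thetaHom, LinearMap.comp_zero, add_zero]

theorem eq_thetaHom_parts (A : O →ₗ[ℂ] SuperRat n) : A = thetaHom (partN A) (partM A) :=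
  eq_thetaHom A

variable [Superalgebra O] [SuperHopfAlgebra O]

theorem factored_eq (R U : O →ₗ[ℂ] RatGrassmann n) :
    factored R U = thetaHom U (-(R ⋆ₛ U)) := by
  have h : unitPoint O (SuperRat n) - thetaTimes R =
      thetaHom (unitPoint O (RatGrassmann n)) (-R) := by
    have h1 : unitPoint O (SuperRat n) = thetaHom (unitPoint O (RatGrassmann n)) 0 := by
      ext x <;> simp [Algebra.algebraMap_eq_smul_one]
    rw [h1, thetaTimes_eq]
    ext x <;> simp
  rw [factored, h, liftTheta_eq, one_sub_theta_superConv]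

theorem parts_mem {A : O →ₗ[ℂ] SuperRat n} (hA : A ∈ lieOdd O (SuperRat n)) :
    partN A ∈ lieOdd O (RatGrassmann n) ∧ partM A ∈ lieEven O (RatGrassmann n) := by
  rw [eq_thetaHom_parts A] at hA
  exact thetaHom_mem_lieOdd_iff.1 hA

theorem reduced_eq {A : O →ₗ[ℂ] SuperRat n} (hA : A ∈ lieOdd O (SuperRat n)) :
    reduced A = partN A ⋆ₛ partN A + partM A := by
  rw [reduced, superBracket_self (parts_mem hA).1]

theorem reduced_mem_lieEven {A : O →ₗ[ℂ] SuperRat n} (hA : A ∈ lieOdd O (SuperRat n)) :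
    reduced A ∈ lieEven O (RatGrassmann n) := by
  rw [reduced_eq hA]
  have h1 := superConv_self_mem_lieEven (RatGrassmann.swapRule n) (parts_mem hA).1
  have h2 := (parts_mem hA).2
  exact ⟨Submodule.add_mem _ h1.1 h2.1, fun x => by simp [h1.2, h2.2]⟩

theorem factored_mem_points {R U : O →ₗ[ℂ] RatGrassmann n}
    (hR : R ∈ lieOdd O (RatGrassmann n)) (hU : U ∈ points O (RatGrassmann n)) :
    factored R U ∈ points O (SuperRat n) := by
  rw [factored_eq]
  exact thetaHom_neg_superConv_mem_points (RatGrassmann.swapRule n) hR hU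

theorem gaugeTransform_factored {A : O →ₗ[ℂ] SuperRat n} (hA : A ∈ lieOdd O (SuperRat n))
    {U : O →ₗ[ℂ] RatGrassmann n} (hU : U ∈ points O (RatGrassmann n)) :
    gaugeTransform (Dtheta n) (factored (partN A) U) A =
      thetaTimes (gaugeTransform (dz n) U (reduced A)) := by
  rw [factored_eq, reduced_eq hA, thetaTimes_eq, ← gaugeTransform_thetaHom (dz n)
    (homPar_eq_neg_of_mem_lieOdd (parts_mem hA).1) hU, ← eq_thetaHom_parts]
  rfl

theorem exists_gaugeTransform_factored_iff (A : O →ₗ[ℂ] SuperRat n)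
    (R : O →ₗ[ℂ] RatGrassmann n) {U : O →ₗ[ℂ] RatGrassmann n}
    (hU : U ∈ points O (RatGrassmann n)) :
    (∃ B, gaugeTransform (Dtheta n) (factored R U) A = thetaTimes B) ↔ R = partN A := by
  have h := gaugeTransform_thetaHom_body_iff (dz n) (N := partN A) (M := partM A)
    (b := -(R ⋆ₛ U)) hU
  rw [← eq_thetaHom_parts, ← factored_eq, neg_inj] at h
  simp only [thetaTimes_eq]
  -- The criterion reads `R ⋆ U = N ⋆ U`, and `U` cancels on the right.
  exact h.trans ⟨superConv_right_cancel hU, fun e => by rw [e]⟩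

theorem exists_gaugeTransform_iff (A : O →ₗ[ℂ] SuperRat n)
    {g : O →ₗ[ℂ] SuperRat n} (hg : g ∈ points O (SuperRat n)) :
    (∃ B, gaugeTransform (Dtheta n) g A = thetaTimes B) ↔
      ∃ U ∈ points O (RatGrassmann n), g = factored (partN A) U := by
  constructor
  · intro h
    have hg' := hg
    rw [eq_thetaHom_parts g] at hg'
    have hU := (thetaHom_mem_points_iff.1 hg').1
    have h1 := gaugeTransform_thetaHom_body_iff (dz n) (N := partN A) (M := partM A)
      (b := partM g) hU
    rw [← eq_thetaHom_parts, ← eq_thetaHom_parts] at h1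
    simp only [thetaTimes_eq] at h
    -- `U` must be the `θ`-free part of `g`; the coefficient of `θ` is then forced.
    refine ⟨partN g, hU, ?_⟩
    rw [factored_eq, ← h1.1 h]
    exact eq_thetaHom_parts g
  · rintro ⟨U, hU, rfl⟩
    exact (exists_gaugeTransform_factored_iff A _ hU).2 rfl

/-- The target `θ Ẑ` has no `θ`-free part, so a twisting `g` must be of the form `(1 - θ N) U`, and
the same `U` serves in both directions. -/
theorem isTwisted_iff_isGaugeConst {A : O →ₗ[ℂ] SuperRat n} (hA : A ∈ lieOdd O (SuperRat n))
    (Z : O →ₗ[ℂ] Grassmann n) : IsTwisted Z A ↔ IsGaugeConst Z (reduced A) := by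
  constructor
  · rintro ⟨g, hg, h⟩
    obtain ⟨U, hU, rfl⟩ := (exists_gaugeTransform_iff A hg).1 ⟨_, h⟩
    rw [gaugeTransform_factored hA hU, thetaTimes_eq, thetaTimes_eq, thetaHom_inj] at h
    exact ⟨U, hU, h.2⟩
  · rintro ⟨U, hU, h⟩
    exact ⟨_, factored_mem_points (parts_mem hA).1 hU, by rw [gaugeTransform_factored hA hU, h]⟩

end Connections

theorem mainTheorem4 {O : Type*} [Ring O] [Algebra ℂ O] [Superalgebra O] [SuperHopfAlgebra O]
    (n : ℕ) :
    (∀ A ∈ lieOdd O (SuperRat n),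
      partN A ∈ lieOdd O (RatGrassmann n) ∧
      partM A ∈ lieEven O (RatGrassmann n) ∧
      A = thetaTimes (partM A) + liftTheta (partN A) ∧
      reduced A ∈ lieEven O (RatGrassmann n) ∧
      (∀ U ∈ points O (RatGrassmann n),
        factored (partN A) U ∈ points O (SuperRat n) ∧
        gaugeTransform (Dtheta n) (factored (partN A) U) A =
          thetaTimes (gaugeTransform (dz n) U (reduced A))) ∧
      (∀ R ∈ lieOdd O (RatGrassmann n), ∀ U ∈ points O (RatGrassmann n),
        (∃ B, gaugeTransform (Dtheta n) (factored R U) A = thetaTimes B) ↔ R = partN A) ∧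
      (∀ g ∈ points O (SuperRat n),
        (∃ B, gaugeTransform (Dtheta n) g A = thetaTimes B) ↔
          ∃ U ∈ points O (RatGrassmann n), g = factored (partN A) U) ∧
      (∀ Z ∈ lieEven O (Grassmann n), IsTwisted Z A ↔ IsGaugeConst Z (reduced A))) ∧
    (∀ (C : ChevalleyGenerators O) (A : O →ₗ[ℂ] SuperRat n), IsMiuraSuperoper C A →
      ∀ Z ∈ lieEven O (Grassmann n), IsTwisted Z A ↔ IsGaugeConst Z (reduced A)) := by
  refine ⟨fun A hA => ⟨(parts_mem hA).1, (parts_mem hA).2, ?_, reduced_mem_lieEven hA,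
    fun U hU => ⟨factored_mem_points (parts_mem hA).1 hU, gaugeTransform_factored hA hU⟩,
    fun R _ U hU => exists_gaugeTransform_factored_iff A R hU,
    fun g hg => exists_gaugeTransform_iff A hg,
    fun Z _ => isTwisted_iff_isGaugeConst hA Z⟩,
    -- A Miura superoper is in particular an odd connection, so the general equivalence specialises.
    fun C A hA Z _ => isTwisted_iff_isGaugeConst hA.1 Z⟩
  rw [thetaTimes_eq, liftTheta_eq, thetaHom_add, zero_add, add_zero]
  exact eq_thetaHom_parts A
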